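/- Let $X_n=\{1,\dots,n\}$ and let $\mathcal I_n$ be the symmetric inverse monoid of partial one-to-one maps of $X_n$ (maps written on the right). A partial isometry is an $\alpha\in\mathcal I_n$ with $|x-y|=|x\alpha-y\alpha|$ for all $x,y\in\operatorname{Dom}\alpha$. Let $\mathcal{ODP}_n$ be the monoid of order-preserving partial isometries of $X_n$, and let $\mathcal{DDP}_n$ be the monoid of order-decreasing partial isometries of $X_n$ (those with $x\alpha\le x$ for all $x\in\operatorname{Dom}\alpha$). The height of $\alpha$ is $|\operatorname{Im}\alpha|$. On a monoid $S$, let $\mathcal D=\mathcal L\vee\mathcal R$ be Green's relation, and let $\mathcal D^*=\mathcal L^*\vee\mathcal R^*$, where $(a,b)\in\mathcal L^*$ iff for all $x,y\in S$: $ax=ay\Leftrightarrow bx=by$, and $(a,b)\in\mathcal R^*$ iff for all $x,y\in S$: $xa=ya\Leftrightarrow xb=yb$. Say that two distinct $\mathcal D$-classes $C\neq C'$ of $\mathcal{ODP}_n$ are merged into a single $\mathcal D^*$-class of $\mathcal{DDP}_n$ if there is one $\mathcal D^*$-class of $\mathcal{DDP}_n$ that contains both $C\cap\mathcal{DDP}_n$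 and $C'\cap\mathcal{DDP}_n$. Let $B(n,p)$ be the number of unordered pairs $\{C,C'\}$ of distinct $\mathcal D$-classes of $\mathcal{ODP}_n$, consisting of maps of height $p$, that are merged into a single $\mathcal D^*$-class of $\mathcal{DDP}_n$. Then for $n\ge p\ge 1$, $$B(n,p)=\begin{cases} \dfrac12\left[\dbinom{\lfloor\frac{n-1}{2}\rfloor}{p-1}-\dbinom{\lfloor\frac{n-1}{4}\rfloor}{\frac{p-1}{2}}\right], & \text{if } p \text{ is odd};\\[3ex] \dfrac12\left[\dbinom{\lfloor\frac{n-1}{2}\rfloor}{p-1}-2\dbinom{\lfloor\frac{n-1}{4}\rfloor}{\frac{p}{2}}\right], & \text{if } n\equiv 1,2 \pmod 4 \text{ and } p \text{ is even};\\[3ex] \dfrac12\left[\dbinom{\lfloor\frac{n-1}{2}\rfloor}{p-1}-2\dbinom{\lfloor\frac{n-3}{4}\rfloor}{\frac{p}{2}}-\dbinom{\lfloor\frac{n-3}{4}\rfloor}{\frac{p-2}{2}}\right], & \text{if } n\equiv -1,0 \pmod 4 \text{ and } p \text{ is even}. \end{cases}$$ -/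

import Mathlib

/-- The symmetric inverse monoid `I_n`: partial one-to-one maps of an `n`-element chain.
The chain `{1, …, n}` is represented by `Fin n` (shifting all points by one changes neither the
order nor distances). For `α : SymInv n`, `y ∈ α x` says that `x` is in the domain of `α`
and that `α` maps `x` to `y`. -/
def SymInv (n : ℕ) : Type := Fin n ≃. Fin n

namespace SymInv

/-- `α.Maps x y`: the point `x` is in the domain of `α` and `xα = y`. -/
def Maps {n : ℕ} (α : SymInv n) (x y : Fin n) : Prop :=
  y ∈ (show Fin n ≃. Fin n from α) x

/-- Maps are written on the right: `α * β` is "first `α`, then `β`". -/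
instance instMonoid (n : ℕ) : Monoid (SymInv n) where
  mul α β := PEquiv.trans α β
  one := PEquiv.refl (Fin n)
  mul_assoc α β γ := PEquiv.trans_assoc α β γ
  one_mul α := PEquiv.refl_trans α
  mul_one α := PEquiv.trans_refl α

theorem maps_mul {n : ℕ} (α β : SymInv n) (x z : Fin n) :
    (α * β).Maps x z ↔ ∃ y, α.Maps x y ∧ β.Maps y z :=
  PEquiv.mem_trans α β x z

theorem maps_one {n : ℕ} (x y : Fin n) : (1 : SymInv n).Maps x y ↔ x = y := by
  change y ∈ some x ↔ x = y
  simp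

/-- The image of a partial map. -/
def im {n : ℕ} (α : SymInv n) : Set (Fin n) := {y | ∃ x, α.Maps x y}

/-- The height (rank) of a partial map is the size of its image. -/
noncomputable def height {n : ℕ} (α : SymInv n) : ℕ := α.im.ncard

end SymInv

/-- `DP_n`: the partial isometries of the `n`-chain. -/
def DP (n : ℕ) : Submonoid (SymInv n) where
  carrier := {α | ∀ x x' y y' : Fin n, α.Maps x y → α.Maps x' y' →
    |((x : ℕ) : ℤ) - ((x' : ℕ) : ℤ)| = |((y : ℕ) : ℤ) - ((y' : ℕ) : ℤ)|}
  mul_mem' := by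
    intro α β hα hβ x x' z z' h h'
    obtain ⟨y, h1, h2⟩ := (SymInv.maps_mul α β x z).1 h
    obtain ⟨y', h1', h2'⟩ := (SymInv.maps_mul α β x' z').1 h'
    exact (hα x x' y y' h1 h1').trans (hβ y y' z z' h2 h2')
  one_mem' := by
    intro x x' y y' h h'
    rw [(SymInv.maps_one x y).1 h, (SymInv.maps_one x' y').1 h']

/-- The order-preserving partial one-to-one maps of the `n`-chain. -/
def OrderPreserving (n : ℕ) : Submonoid (SymInv n) where
  carrier := {α | ∀ x x' y y' : Fin n, α.Maps x y → α.Maps x' y' → x ≤ x' → y ≤ y'}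
  mul_mem' := by
    intro α β hα hβ x x' z z' h h' hle
    obtain ⟨y, h1, h2⟩ := (SymInv.maps_mul α β x z).1 h
    obtain ⟨y', h1', h2'⟩ := (SymInv.maps_mul α β x' z').1 h'
    exact hβ y y' z z' h2 h2' (hα x x' y y' h1 h1' hle)
  one_mem' := by
    intro x x' y y' h h' hle
    rwa [← (SymInv.maps_one x y).1 h, ← (SymInv.maps_one x' y').1 h']

/-- The order-decreasing partial one-to-one maps of the `n`-chain. -/
def OrderDecreasing (n : ℕ) : Submonoid (SymInv n) where
  carrier := {α | ∀ x y : Fin n, α.Maps x y → y ≤ x}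
  mul_mem' := by
    intro α β hα hβ x z h
    obtain ⟨y, h1, h2⟩ := (SymInv.maps_mul α β x z).1 h
    exact (hβ y z h2).trans (hα x y h1)
  one_mem' := by
    intro x y h
    exact ((SymInv.maps_one x y).1 h).ge

/-- `ODP_n`: the order-preserving partial isometries of the `n`-chain. -/
def ODP (n : ℕ) : Submonoid (SymInv n) := DP n ⊓ OrderPreserving n

/-- `DDP_n`: the order-decreasing partial isometries of the `n`-chain. -/
def DDP (n : ℕ) : Submonoid (SymInv n) := DP n ⊓ OrderDecreasing n

/-- Green's relation `L` on a monoid: `a` and `b` generate the same principal left ideal. -/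
def greenL (M : Type*) [Monoid M] : Setoid M where
  r a b := (∃ u, u * a = b) ∧ (∃ v, v * b = a)
  iseqv :=
    { refl := fun a => ⟨⟨1, one_mul a⟩, ⟨1, one_mul a⟩⟩
      symm := fun h => ⟨h.2, h.1⟩
      trans := by
        rintro a b c ⟨⟨u, rfl⟩, ⟨v, hv⟩⟩ ⟨⟨u', rfl⟩, ⟨v', hv'⟩⟩
        exact ⟨⟨u' * u, mul_assoc _ _ _⟩, ⟨v * v', by rw [mul_assoc, hv', hv]⟩⟩ }

/-- Green's relation `R` on a monoid: `a` and `b` generate the same principal right ideal. -/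
def greenR (M : Type*) [Monoid M] : Setoid M where
  r a b := (∃ u, a * u = b) ∧ (∃ v, b * v = a)
  iseqv :=
    { refl := fun a => ⟨⟨1, mul_one a⟩, ⟨1, mul_one a⟩⟩
      symm := fun h => ⟨h.2, h.1⟩
      trans := by
        rintro a b c ⟨⟨u, rfl⟩, ⟨v, hv⟩⟩ ⟨⟨u', rfl⟩, ⟨v', hv'⟩⟩
        exact ⟨⟨u * u', (mul_assoc _ _ _).symm⟩, ⟨v' * v, by rw [← mul_assoc, hv', hv]⟩⟩ }

/-- Green's relation `D`: the join of `L` and `R` in the lattice of equivalence relations. -/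
def greenD (M : Type*) [Monoid M] : Setoid M := greenL M ⊔ greenR M

/-- The starred Green's relation `L*` on a monoid: `ax = ay ↔ bx = by` for all `x, y`. -/
def greenLStar (M : Type*) [Monoid M] : Setoid M where
  r a b := ∀ x y : M, a * x = a * y ↔ b * x = b * y
  iseqv :=
    { refl := fun _ _ _ => Iff.rfl
      symm := fun h x y => (h x y).symm
      trans := fun h k x y => (h x y).trans (k x y) }

/-- The starred Green's relation `R*` on a monoid: `xa = ya ↔ xb = yb` for all `x, y`. -/
def greenRStar (M : Type*) [Monoid M] : Setoid M where
  r a b := ∀ x y : M, x * a = y * a ↔ x * b = y * b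
  iseqv :=
    { refl := fun _ _ _ => Iff.rfl
      symm := fun h x y => (h x y).symm
      trans := fun h k x y => (h x y).trans (k x y) }

/-- The starred Green's relation `D*`: the join of `L*` and `R*`. -/
def greenDStar (M : Type*) [Monoid M] : Setoid M := greenLStar M ⊔ greenRStar M

/-- The `D`-classes of `ODP_n` that consist of maps of height `p`. -/
def heightClasses (n p : ℕ) : Set (Set (ODP n)) :=
  {C | C ∈ (greenD (ODP n)).classes ∧ ∀ α ∈ C, (α : SymInv n).height = p}

/-- The members of `C ⊆ ODP_n` that are order-decreasing, as elements of `DDP_n`.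
(This part is nonempty for every `D`-class `C` of `ODP_n`, since `C` contains the partial
identities on the domains and the images of its elements.) -/
def decreasingPart {n : ℕ} (C : Set (ODP n)) : Set (DDP n) :=
  {β | ∃ α ∈ C, (α : SymInv n) = (β : SymInv n)}

/-- Two distinct `D`-classes `C`, `C'` of `ODP_n` are merged into a single `D*`-class of `DDP_n`:
the members of both classes that lie in `DDP_n` lie in one and the same `D*`-class of `DDP_n`. -/
def Merged {n : ℕ} (C C' : Set (ODP n)) : Prop :=
  C ≠ C' ∧ ∃ K ∈ (greenDStar (DDP n)).classes, decreasingPart C ⊆ K ∧ decreasingPart C' ⊆ K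

/-- `B(n, p)`: the number of unordered pairs of distinct `D`-classes of `ODP_n` consisting of maps
of height `p` that are merged into single `D*`-classes of `DDP_n`. -/
noncomputable def B (n p : ℕ) : ℕ :=
  {P : Sym2 (Set (ODP n)) | ∃ C ∈ heightClasses n p, ∃ C' ∈ heightClasses n p,
    Merged C C' ∧ P = s(C, C')}.ncard

/-! Both relations depend only on images, viewed as sets of integers. An order-preserving partial
isometry is a translation, and $\mathcal{ODP}_n$ is closed under inverses, so its $\mathcal
D$-classes correspond to images up to translation (`greenD_iff`).

In $\mathcal{DDP}_n$, $\mathcal L^*$ is equality of images and $\mathcal R^*$ is equality of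
domains, so $\mathcal D^*$ links the domain of each element to its image. Translations contribute
nothing new. A reflection $x\mapsto c-x$ that is decreasing and stays in the chain needs max ≤ c ≤ 2
min on its domain, which forces the diameter to be at most $(n-1)/2$; conversely, a set that narrow
can be pushed to the right end of the chain and reflected there. Hence `greenDStar_iff`.

Translating each image to have minimum 0 turns classes into shapes. With $m=\lfloor (n-1)/2\rfloor$,
the merged pairs are the pairs {S, `mirror S`} with S a non-symmetric $p$-subset of $\{0,\dots,m\}$
containing 0. There are $\binom{m}{p-1}$ such subsets in all, so
$2B(n,p)=\binom{m}{p-1}-\#\text{palindromes}$ (`two_mul_B`). Palindromes are counted by folding them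
at their centre, which is an integer or a half-integer. -/

namespace SymInv

/-! ### Partial maps, their domains and images as sets of integers -/

variable {n : ℕ}

theorem ext_maps {α β : SymInv n} (h : ∀ x y, α.Maps x y ↔ β.Maps x y) : α = β :=
  PEquiv.ext fun x => Option.ext fun y => h x y

theorem Maps.right_unique {α : SymInv n} {x y y' : Fin n} (h : α.Maps x y) (h' : α.Maps x y') :
    y = y' :=
  Option.mem_unique h h'

theorem Maps.left_unique {α : SymInv n} {x x' y : Fin n} (h : α.Maps x y) (h' : α.Maps x' y) :
    x = x' :=
  PEquiv.inj _ h h'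

open Classical in
theorem exists_maps_iff (R : Fin n → Fin n → Prop) (hr : ∀ x y y', R x y → R x y' → y = y')
    (hl : ∀ x x' y, R x y → R x' y → x = x') : ∃ γ : SymInv n, ∀ x y, γ.Maps x y ↔ R x y := by
  have key : ∀ x y, (if h : ∃ y, R x y then some h.choose else none) = some y ↔ R x y := by
    intro x y
    split_ifs with h
    · simp only [Option.some.injEq]
      exact ⟨fun e => e ▸ h.choose_spec, fun e => hr _ _ _ h.choose_spec e⟩
    · simp only [false_iff]
      exact fun e => h ⟨y, e⟩
  have key' : ∀ y x, (if h : ∃ x, R x y then some h.choose else none) = some x ↔ R x y := by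
    intro y x
    split_ifs with h
    · simp only [Option.some.injEq]
      exact ⟨fun e => e ▸ h.choose_spec, fun e => hl _ _ _ h.choose_spec e⟩
    · simp only [false_iff]
      exact fun e => h ⟨x, e⟩
  let γ : Fin n ≃. Fin n :=
    { toFun := fun x => if h : ∃ y, R x y then some h.choose else none
      invFun := fun y => if h : ∃ x, R x y then some h.choose else none
      inv := fun x y => (key' y x).trans (key x y).symm }
  exact ⟨γ, key⟩

/-- The domain of a partial map, as a set of integers. -/
def domZ (α : SymInv n) : Set ℤ := {z | ∃ x y, α.Maps x y ∧ ((x : ℕ) : ℤ) = z}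

/-- The image of a partial map, as a set of integers. -/
def imZ (α : SymInv n) : Set ℤ := {z | ∃ x y, α.Maps x y ∧ ((y : ℕ) : ℤ) = z}

theorem mem_domZ {α : SymInv n} (x : Fin n) : ((x : ℕ) : ℤ) ∈ α.domZ ↔ ∃ y, α.Maps x y := by
  constructor
  · rintro ⟨x', y, h, e⟩
    obtain rfl : x' = x := Fin.ext (by exact_mod_cast e)
    exact ⟨y, h⟩
  · rintro ⟨y, h⟩
    exact ⟨x, y, h, rfl⟩

theorem mem_imZ {α : SymInv n} (y : Fin n) : ((y : ℕ) : ℤ) ∈ α.imZ ↔ ∃ x, α.Maps x y := by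
  constructor
  · rintro ⟨x, y', h, e⟩
    obtain rfl : y' = y := Fin.ext (by exact_mod_cast e)
    exact ⟨x, h⟩
  · rintro ⟨x, h⟩
    exact ⟨x, y, h, rfl⟩

theorem domZ_subset (α : SymInv n) : α.domZ ⊆ Set.Ico 0 (n : ℤ) := by
  rintro _ ⟨x, y, -, rfl⟩
  exact ⟨by omega, by have := x.2; omega⟩

theorem imZ_subset (α : SymInv n) : α.imZ ⊆ Set.Ico 0 (n : ℤ) := by
  rintro _ ⟨x, y, -, rfl⟩
  exact ⟨by omega, by have := y.2; omega⟩

theorem height_eq_ncard_imZ (α : SymInv n) : α.height = α.imZ.ncard := by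
  have : α.imZ = (fun y : Fin n => ((y : ℕ) : ℤ)) '' α.im := by
    ext z
    constructor
    · rintro ⟨x, y, h, rfl⟩
      exact ⟨y, ⟨x, h⟩, rfl⟩
    · rintro ⟨y, ⟨x, h⟩, rfl⟩
      exact ⟨x, y, h, rfl⟩
  rw [this, Set.ncard_image_of_injective, height]
  intro y y' h
  exact Fin.ext (Int.ofNat.inj h)

theorem domZ_mul_subset (α β : SymInv n) : (α * β).domZ ⊆ α.domZ := by
  rintro _ ⟨x, z, h, rfl⟩
  obtain ⟨y, h, -⟩ := (maps_mul _ _ _ _).1 h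
  exact ⟨x, y, h, rfl⟩

theorem imZ_mul_subset (α β : SymInv n) : (α * β).imZ ⊆ β.imZ := by
  rintro _ ⟨x, z, h, rfl⟩
  obtain ⟨y, -, h⟩ := (maps_mul _ _ _ _).1 h
  exact ⟨y, z, h, rfl⟩

/-- The partial maps with graph `y = f x` on a set of integers. -/
theorem exists_graph {A B : Set ℤ} (hA : A ⊆ Set.Ico 0 (n : ℤ)) (hB : B ⊆ Set.Ico 0 (n : ℤ))
    (f : ℤ → ℤ) (hf : Function.Injective f) (hAB : ∀ z ∈ A, f z ∈ B)
    (hBA : ∀ z ∈ B, ∃ w ∈ A, f w = z) :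
    ∃ γ : SymInv n, γ.domZ = A ∧ γ.imZ = B ∧
      ∀ x y, γ.Maps x y → ((x : ℕ) : ℤ) ∈ A ∧ ((y : ℕ) : ℤ) = f ((x : ℕ) : ℤ) := by
  obtain ⟨γ, hγ⟩ := exists_maps_iff
    (fun x y : Fin n => ((x : ℕ) : ℤ) ∈ A ∧ ((y : ℕ) : ℤ) = f ((x : ℕ) : ℤ))
    (fun x y y' h h' => Fin.ext (by have := h.2.trans h'.2.symm; exact_mod_cast this))
    (fun x x' y h h' => Fin.ext (by have := hf (h.2.symm.trans h'.2); exact_mod_cast this))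
  have lift : ∀ z ∈ Set.Ico 0 (n : ℤ), ∃ x : Fin n, ((x : ℕ) : ℤ) = z := fun z hz =>
    ⟨⟨z.toNat, by have := hz.1; have := hz.2; omega⟩, by have := hz.1; simp only; omega⟩
  refine ⟨γ, ?_, ?_, fun x y h => (hγ x y).1 h⟩
  · ext z
    constructor
    · rintro ⟨x, y, h, rfl⟩
      exact ((hγ x y).1 h).1
    · intro hz
      obtain ⟨x, rfl⟩ := lift z (hA hz)
      obtain ⟨y, hy⟩ := lift _ (hB (hAB _ hz))
      exact ⟨x, y, (hγ x y).2 ⟨hz, hy⟩, rfl⟩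
  · ext z
    constructor
    · rintro ⟨x, y, h, rfl⟩
      obtain ⟨h1, h2⟩ := (hγ x y).1 h
      exact h2 ▸ hAB _ h1
    · intro hz
      obtain ⟨w, hw, e⟩ := hBA z hz
      obtain ⟨x, rfl⟩ := lift w (hA hw)
      obtain ⟨y, rfl⟩ := lift z (hB hz)
      exact ⟨x, y, (hγ x y).2 ⟨hw, e.symm⟩, rfl⟩

theorem exists_symm (α : SymInv n) : ∃ β : SymInv n, ∀ x y, β.Maps x y ↔ α.Maps y x :=
  exists_maps_iff _ (fun _ _ _ h h' => h.left_unique h') (fun _ _ _ h h' => h.right_unique h')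

theorem mul_eq_of_domZ_eq {α α' γ : SymInv n} (hα' : ∀ x y, α'.Maps x y ↔ α.Maps y x)
    (h : γ.domZ ⊆ α.domZ) : α * (α' * γ) = γ := by
  refine ext_maps fun x z => ?_
  simp only [maps_mul, hα']
  constructor
  · rintro ⟨y, h1, x', h2, h3⟩
    rwa [h1.left_unique h2]
  · intro h3
    obtain ⟨y, hy⟩ := (mem_domZ x).1 (h ⟨x, z, h3, rfl⟩)
    exact ⟨y, hy, x, hy, h3⟩

theorem mul_eq_of_imZ_eq {α α' γ : SymInv n} (hα' : ∀ x y, α'.Maps x y ↔ α.Maps y x)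
    (h : γ.imZ ⊆ α.imZ) : γ * α' * α = γ := by
  refine ext_maps fun x z => ?_
  simp only [maps_mul, hα']
  constructor
  · rintro ⟨y, ⟨z', h1, h2⟩, h3⟩
    rwa [h3.right_unique h2]
  · intro h3
    obtain ⟨y, hy⟩ := (mem_imZ z).1 (h ⟨x, z, h3, rfl⟩)
    exact ⟨y, ⟨z, h3, hy⟩, hy⟩

/-- The product `a * x` sees only the restriction of `x` to the image of `a`. This and its dual give
$\mathcal L^*$ and $\mathcal R^*$ from equal images and equal domains, without inverses. -/
theorem mul_left_congr {a b x y : SymInv n} (h : b.imZ ⊆ a.imZ) (e : a * x = a * y) :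
    b * x = b * y := by
  have key : ∀ x y : SymInv n, a * x = a * y → ∀ p q, (b * x).Maps p q → (b * y).Maps p q := by
    intro x y e p q hpq
    obtain ⟨r, h1, h2⟩ := (maps_mul _ _ _ _).1 hpq
    obtain ⟨s, hs⟩ := (mem_imZ r).1 (h ⟨p, r, h1, rfl⟩)
    have : (a * x).Maps s q := (maps_mul _ _ _ _).2 ⟨r, hs, h2⟩
    rw [e] at this
    obtain ⟨r', h3, h4⟩ := (maps_mul _ _ _ _).1 this
    rw [← hs.right_unique h3] at h4
    exact (maps_mul _ _ _ _).2 ⟨r, h1, h4⟩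
  exact ext_maps fun p q => ⟨key x y e p q, key y x e.symm p q⟩

theorem mul_right_congr {a b x y : SymInv n} (h : b.domZ ⊆ a.domZ) (e : x * a = y * a) :
    x * b = y * b := by
  have key : ∀ x y : SymInv n, x * a = y * a → ∀ p q, (x * b).Maps p q → (y * b).Maps p q := by
    intro x y e p q hpq
    obtain ⟨r, h1, h2⟩ := (maps_mul _ _ _ _).1 hpq
    obtain ⟨s, hs⟩ := (mem_domZ r).1 (h ⟨r, q, h2, rfl⟩)
    have : (x * a).Maps p s := (maps_mul _ _ _ _).2 ⟨r, h1, hs⟩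
    rw [e] at this
    obtain ⟨r', h3, h4⟩ := (maps_mul _ _ _ _).1 this
    rw [← hs.left_unique h4] at h3
    exact (maps_mul _ _ _ _).2 ⟨r, h3, h2⟩
  exact ext_maps fun p q => ⟨key x y e p q, key y x e.symm p q⟩

theorem imZ_subset_of_mul_eq {a b e : SymInv n} (he : ∀ x y, e.Maps x y → x = y ∧
    ((x : ℕ) : ℤ) ∈ a.imZ) (h : b * e = b) : b.imZ ⊆ a.imZ := by
  rintro _ ⟨x, y, hxy, rfl⟩
  rw [← h] at hxy
  obtain ⟨z, -, h2⟩ := (maps_mul _ _ _ _).1 hxy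
  obtain ⟨rfl, h⟩ := he _ _ h2
  exact h

theorem domZ_subset_of_mul_eq {a b e : SymInv n} (he : ∀ x y, e.Maps x y → x = y ∧
    ((x : ℕ) : ℤ) ∈ a.domZ) (h : e * b = b) : b.domZ ⊆ a.domZ := by
  rintro _ ⟨x, y, hxy, rfl⟩
  rw [← h] at hxy
  obtain ⟨z, h2, -⟩ := (maps_mul _ _ _ _).1 hxy
  exact (he _ _ h2).2

end SymInv

/-! ### Translates, reflections and narrow sets -/

/-- `B` is a translate of `A`. -/
def Translate (A B : Set ℤ) : Prop := ∃ t, ∀ z, z ∈ A ↔ z + t ∈ B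

/-- `B` is a reflection of `A`. -/
def Reflection (A B : Set ℤ) : Prop := ∃ c, ∀ z, z ∈ A ↔ c - z ∈ B

/-- The diameter of `A` is at most `(n - 1) / 2`. -/
def Narrow (n : ℕ) (A : Set ℤ) : Prop := ∀ x ∈ A, ∀ y ∈ A, 2 * (x - y) ≤ n - 1

/-- `B` is a translate of `A`, or `A` is narrow and `B` is a reflection of `A`. -/
def Sim (n : ℕ) (A B : Set ℤ) : Prop := Translate A B ∨ Narrow n A ∧ Reflection A B

theorem Translate.refl (A : Set ℤ) : Translate A A := ⟨0, by simp⟩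

theorem Translate.symm {A B : Set ℤ} : Translate A B → Translate B A := by
  rintro ⟨t, h⟩
  exact ⟨-t, fun z => by rw [h]; simp⟩

theorem Translate.trans {A B C : Set ℤ} : Translate A B → Translate B C → Translate A C := by
  rintro ⟨t, h⟩ ⟨s, k⟩
  exact ⟨t + s, fun z => by rw [h, k, add_assoc]⟩

theorem Reflection.symm {A B : Set ℤ} : Reflection A B → Reflection B A := by
  rintro ⟨t, h⟩
  exact ⟨t, fun z => by rw [h]; simp⟩

theorem Reflection.trans {A B C : Set ℤ} : Reflection A B → Reflection B C → Translate A C := by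
  rintro ⟨t, h⟩ ⟨s, k⟩
  exact ⟨s - t, fun z => by rw [h, k, show s - (t - z) = z + (s - t) by ring]⟩

theorem Reflection.trans_translate {A B C : Set ℤ} :
    Reflection A B → Translate B C → Reflection A C := by
  rintro ⟨t, h⟩ ⟨s, k⟩
  exact ⟨t + s, fun z => by rw [h, k, show t - z + s = t + s - z by ring]⟩

theorem Translate.trans_reflection {A B C : Set ℤ} (h : Translate A B) (k : Reflection B C) :
    Reflection A C :=
  (k.symm.trans_translate h.symm).symm

theorem Translate.narrow {n : ℕ} {A B : Set ℤ} : Translate A B → Narrow n A → Narrow n B := by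
  rintro ⟨t, h⟩ hA x hx y hy
  have := hA (x - t) ((h _).2 (by simpa)) (y - t) ((h _).2 (by simpa))
  linarith

theorem Reflection.narrow {n : ℕ} {A B : Set ℤ} : Reflection A B → Narrow n A → Narrow n B := by
  rintro ⟨t, h⟩ hA x hx y hy
  have := hA (t - y) ((h _).2 (by simpa)) (t - x) ((h _).2 (by simpa))
  linarith

theorem Sim.symm {n : ℕ} {A B : Set ℤ} : Sim n A B → Sim n B A := by
  rintro (h | ⟨h, k⟩)
  · exact .inl h.symm
  · exact .inr ⟨k.narrow h, k.symm⟩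

theorem Sim.trans {n : ℕ} {A B C : Set ℤ} : Sim n A B → Sim n B C → Sim n A C := by
  rintro (h | ⟨h, k⟩) (h₂ | ⟨h₂, k₂⟩)
  · exact .inl (h.trans h₂)
  · exact .inr ⟨h.symm.narrow h₂, h.trans_reflection k₂⟩
  · exact .inr ⟨h, k.trans_translate h₂⟩
  · exact .inl (k.trans k₂)

/-- The translation relation as an equivalence relation. -/
def translateSetoid : Setoid (Set ℤ) := ⟨Translate, Translate.refl, Translate.symm, Translate.trans⟩

/-- The relation `Sim n` as an equivalence relation. -/
def simSetoid (n : ℕ) : Setoid (Set ℤ) :=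
  ⟨Sim n, fun A => .inl (.refl A), Sim.symm, Sim.trans⟩

namespace SymInv

variable {n : ℕ}

theorem translate_of_maps {α : SymInv n} {t : ℤ}
    (h : ∀ x y, α.Maps x y → ((y : ℕ) : ℤ) = ((x : ℕ) : ℤ) + t) : Translate α.domZ α.imZ := by
  refine ⟨t, fun z => ⟨?_, ?_⟩⟩
  · rintro ⟨x, y, hxy, rfl⟩
    exact ⟨x, y, hxy, h x y hxy⟩
  · rintro ⟨x, y, hxy, e⟩
    exact ⟨x, y, hxy, by have := h x y hxy; omega⟩

theorem reflection_of_maps {α : SymInv n} {c : ℤ}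
    (h : ∀ x y, α.Maps x y → ((y : ℕ) : ℤ) = c - ((x : ℕ) : ℤ)) : Reflection α.domZ α.imZ := by
  refine ⟨c, fun z => ⟨?_, ?_⟩⟩
  · rintro ⟨x, y, hxy, rfl⟩
    exact ⟨x, y, hxy, h x y hxy⟩
  · rintro ⟨x, y, hxy, e⟩
    exact ⟨x, y, hxy, by have := h x y hxy; omega⟩

end SymInv

/-! ### Green's relation D on ODP and the relation D* on DDP -/

section Classes

open SymInv

variable {n : ℕ}

theorem translate_of_mem_ODP {α : SymInv n} (h : α ∈ ODP n) : Translate α.domZ α.imZ := by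
  by_cases hne : ∃ x y, α.Maps x y
  · obtain ⟨x₀, y₀, h₀⟩ := hne
    refine translate_of_maps (t := ((y₀ : ℕ) : ℤ) - ((x₀ : ℕ) : ℤ)) fun x y hxy => ?_
    have h1 := h.1 _ _ _ _ h₀ hxy
    have h2 := h.2 _ _ _ _ h₀ hxy
    have h3 := h.2 _ _ _ _ hxy h₀
    rw [Fin.le_def, Fin.le_def] at h2 h3
    rcases abs_eq_abs.1 h1 with h1 | h1 <;> omega
  · push Not at hne
    exact translate_of_maps (t := 0) fun x y hxy => absurd hxy (hne x y)

theorem exists_extremal {α : SymInv n} (hne : ∃ x y, α.Maps x y) :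
    ∃ x₀ y₀ x₁ y₁, α.Maps x₀ y₀ ∧ α.Maps x₁ y₁ ∧ ∀ x y, α.Maps x y → x₀ ≤ x ∧ x ≤ x₁ := by
  classical
  let s : Finset (Fin n) := Finset.univ.filter fun x => ∃ y, α.Maps x y
  have hs : s.Nonempty := by
    obtain ⟨x, hx⟩ := hne
    exact ⟨x, by simpa [s] using hx⟩
  obtain ⟨y₀, h₀⟩ := (Finset.mem_filter.1 (s.min'_mem hs)).2
  obtain ⟨y₁, h₁⟩ := (Finset.mem_filter.1 (s.max'_mem hs)).2
  refine ⟨_, y₀, _, y₁, h₀, h₁, fun x y h => ?_⟩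
  have : x ∈ s := Finset.mem_filter.2 ⟨Finset.mem_univ _, y, h⟩
  exact ⟨s.min'_le _ this, s.le_max' _ this⟩

/-- The distances to the two extreme points of the domain determine every image, so the map is a
translation or a reflection according to the order of the images of those two points. -/
theorem sim_of_mem_DDP {α : SymInv n} (h : α ∈ DDP n) : Sim n α.domZ α.imZ := by
  by_cases hne : ∃ x y, α.Maps x y
  · obtain ⟨x₀, y₀, x₁, y₁, h₀, h₁, hb⟩ := exists_extremal hne
    have e := h.1 _ _ _ _ h₀ h₁
    have hx := Fin.le_def.1 (hb _ _ h₀).2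
    have aux : ∀ x y, α.Maps x y →
        (((x : ℕ) : ℤ) - x₀ = y - y₀ ∨ ((x : ℕ) : ℤ) - x₀ = y₀ - y) ∧
        (((x : ℕ) : ℤ) - x₁ = y - y₁ ∨ ((x : ℕ) : ℤ) - x₁ = y₁ - y) ∧
        (x₀ : ℕ) ≤ x ∧ (x : ℕ) ≤ x₁ ∧ (y : ℕ) ≤ x := by
      intro x y hxy
      have e1 := abs_eq_abs.1 (h.1 _ _ _ _ hxy h₀)
      have e2 := abs_eq_abs.1 (h.1 _ _ _ _ hxy h₁)
      have := hb _ _ hxy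
      have h3 := h.2 _ _ hxy
      rw [Fin.le_def] at h3
      rw [Fin.le_def, Fin.le_def] at this
      omega
    by_cases hy : (y₀ : ℕ) ≤ y₁
    · left
      refine translate_of_maps (t := ((y₀ : ℕ) : ℤ) - ((x₀ : ℕ) : ℤ)) fun x y hxy => ?_
      have := aux x y hxy
      have := aux _ _ h₁
      omega
    · right
      refine ⟨?_, reflection_of_maps (c := ((y₀ : ℕ) : ℤ) + ((x₀ : ℕ) : ℤ)) fun x y hxy => ?_⟩
      -- From 0 ≤ y₁ = y₀ - (x₁ - x₀) and y₀ ≤ x₀ follows x₁ - x₀ ≤ x₀, hence 2(x₁ - x₀) ≤ x₁ ≤ n -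
      -- 1.
      · rintro _ ⟨x, y, hxy, rfl⟩ _ ⟨x', y', hxy', rfl⟩
        have := aux _ _ hxy
        have := aux _ _ hxy'
        have := aux _ _ h₀
        have := aux _ _ h₁
        have := x₁.2
        omega
      · have := aux x y hxy
        have := aux _ _ h₁
        omega
  · push Not at hne
    exact .inl (translate_of_maps (t := 0) fun x y hxy => absurd hxy (hne x y))

theorem mem_ODP_of_maps {α : SymInv n} {t : ℤ}
    (h : ∀ x y, α.Maps x y → ((y : ℕ) : ℤ) = ((x : ℕ) : ℤ) + t) : α ∈ ODP n := by
  constructor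
  · intro x x' y y' hxy hxy'
    rw [h _ _ hxy, h _ _ hxy', add_sub_add_right_eq_sub]
  · intro x x' y y' hxy hxy' hle
    have := h _ _ hxy
    have := h _ _ hxy'
    rw [Fin.le_def] at hle ⊢
    omega

theorem mem_DDP_of_translation {α : SymInv n} {t : ℤ} (ht : t ≤ 0)
    (h : ∀ x y, α.Maps x y → ((y : ℕ) : ℤ) = ((x : ℕ) : ℤ) + t) : α ∈ DDP n := by
  refine ⟨(mem_ODP_of_maps h).1, fun x y hxy => ?_⟩
  have := h _ _ hxy
  rw [Fin.le_def]
  omega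

theorem mem_DDP_of_reflection {α : SymInv n} {c : ℤ}
    (h : ∀ x y, α.Maps x y → ((y : ℕ) : ℤ) = c - ((x : ℕ) : ℤ) ∧ c ≤ 2 * ((x : ℕ) : ℤ)) :
    α ∈ DDP n := by
  refine ⟨fun x x' y y' hxy hxy' => ?_, fun x y hxy => ?_⟩
  · rw [(h _ _ hxy).1, (h _ _ hxy').1, sub_sub_sub_cancel_left, abs_sub_comm]
  · have := h _ _ hxy
    rw [Fin.le_def]
    omega

theorem exists_translation {A B : Set ℤ} (hA : A ⊆ Set.Ico 0 (n : ℤ)) (hB : B ⊆ Set.Ico 0 (n : ℤ))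
    {t : ℤ} (h : ∀ z, z ∈ A ↔ z + t ∈ B) : ∃ γ : SymInv n, γ.domZ = A ∧ γ.imZ = B ∧
      ∀ x y, γ.Maps x y → ((x : ℕ) : ℤ) ∈ A ∧ ((y : ℕ) : ℤ) = ((x : ℕ) : ℤ) + t :=
  exists_graph hA hB (· + t) (add_left_injective t) (fun z hz => (h z).1 hz)
    (fun z hz => ⟨z - t, (h _).2 (by simpa), by simp⟩)

/-- The partial identities. -/
theorem exists_partial_id {A : Set ℤ} (hA : A ⊆ Set.Ico 0 (n : ℤ)) :
    ∃ γ : SymInv n, γ.domZ = A ∧ γ.imZ = A ∧ γ ∈ ODP n ∧ γ ∈ DDP n ∧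
      ∀ x y, γ.Maps x y → x = y ∧ ((x : ℕ) : ℤ) ∈ A := by
  obtain ⟨γ, h1, h2, h3⟩ := exists_translation hA hA (t := 0) (by simp)
  refine ⟨γ, h1, h2, mem_ODP_of_maps fun x y h => (h3 x y h).2,
    mem_DDP_of_translation le_rfl fun x y h => (h3 x y h).2, fun x y h => ⟨?_, (h3 x y h).1⟩⟩
  have := (h3 x y h).2
  exact Fin.ext (by omega)

theorem symm_mem_ODP {α α' : SymInv n} (h : α ∈ ODP n)
    (hα' : ∀ x y, α'.Maps x y ↔ α.Maps y x) : α' ∈ ODP n := by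
  constructor
  · intro x x' y y' hxy hxy'
    exact (h.1 _ _ _ _ ((hα' _ _).1 hxy) ((hα' _ _).1 hxy')).symm
  · intro x x' y y' hxy hxy' hle
    rw [hα'] at hxy hxy'
    by_contra hlt
    have := h.2 _ _ _ _ hxy' hxy (not_le.1 hlt).le
    obtain rfl := le_antisymm hle this
    exact hlt (hxy.left_unique hxy').le

theorem greenR_of_domZ_eq {a b : ODP n} (h : (a : SymInv n).domZ = (b : SymInv n).domZ) :
    greenR (ODP n) a b := by
  have key : ∀ a b : ODP n, (a : SymInv n).domZ = (b : SymInv n).domZ → ∃ u, a * u = b := by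
    intro a b h
    obtain ⟨a', ha'⟩ := exists_symm (a : SymInv n)
    exact ⟨⟨a', symm_mem_ODP a.2 ha'⟩ * b, Subtype.ext (mul_eq_of_domZ_eq ha' h.ge)⟩
  exact ⟨key a b h, key b a h.symm⟩

theorem greenL_of_imZ_eq {a b : ODP n} (h : (a : SymInv n).imZ = (b : SymInv n).imZ) :
    greenL (ODP n) a b := by
  have key : ∀ a b : ODP n, (a : SymInv n).imZ = (b : SymInv n).imZ → ∃ u, u * a = b := by
    intro a b h
    obtain ⟨a', ha'⟩ := exists_symm (a : SymInv n)
    exact ⟨b * ⟨a', symm_mem_ODP a.2 ha'⟩, Subtype.ext (mul_eq_of_imZ_eq ha' h.ge)⟩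
  exact ⟨key a b h, key b a h.symm⟩

theorem greenD_iff {a b : ODP n} :
    greenD (ODP n) a b ↔ Translate (a : SymInv n).imZ (b : SymInv n).imZ := by
  constructor
  · have : greenD (ODP n) ≤ translateSetoid.comap fun a : ODP n => (a : SymInv n).imZ := by
      refine sup_le ?_ ?_
      · rintro a b ⟨⟨u, rfl⟩, ⟨v, hv⟩⟩
        have e : (a : SymInv n).imZ = ((u * a : ODP n) : SymInv n).imZ := by
          refine subset_antisymm ?_ (imZ_mul_subset _ _)
          conv_lhs => rw [← hv]
          exact imZ_mul_subset _ _
        change Translate (a : SymInv n).imZ ((u * a : ODP n) : SymInv n).imZ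
        rw [← e]
        exact .refl _
      · rintro a b ⟨⟨u, rfl⟩, ⟨v, hv⟩⟩
        have e : (a : SymInv n).domZ = ((a * u : ODP n) : SymInv n).domZ := by
          refine subset_antisymm ?_ (domZ_mul_subset _ _)
          conv_lhs => rw [← hv]
          exact domZ_mul_subset _ _
        have h1 := translate_of_mem_ODP a.2
        have h2 := translate_of_mem_ODP (a * u).2
        rw [← e] at h2
        exact h1.symm.trans h2
    exact fun h => this h
  · intro h
    -- The translation `γ` from the domain of `a` onto the image of `b` satisfies a R γ L b.
    obtain ⟨t, ht⟩ := (translate_of_mem_ODP a.2).trans h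
    obtain ⟨γ, h1, h2, h3⟩ := exists_translation (domZ_subset _) (imZ_subset _) ht
    let g : ODP n := ⟨γ, mem_ODP_of_maps fun x y h => (h3 x y h).2⟩
    have k1 : greenD (ODP n) a g := le_sup_right (a := greenL (ODP n)) (greenR_of_domZ_eq h1.symm)
    have k2 : greenD (ODP n) g b := le_sup_left (b := greenR (ODP n)) (greenL_of_imZ_eq h2)
    exact Setoid.trans' _ k1 k2

theorem greenDStar_of_imZ_eq {a b : DDP n} (h : (a : SymInv n).imZ = (b : SymInv n).imZ) :
    greenDStar (DDP n) a b := by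
  have : greenLStar (DDP n) a b := fun x y => by
    simp only [Subtype.ext_iff, Submonoid.coe_mul]
    exact ⟨mul_left_congr h.ge, mul_left_congr h.le⟩
  exact le_sup_left (b := greenRStar (DDP n)) this

theorem greenDStar_of_domZ_eq {a b : DDP n} (h : (a : SymInv n).domZ = (b : SymInv n).domZ) :
    greenDStar (DDP n) a b := by
  have : greenRStar (DDP n) a b := fun x y => by
    simp only [Subtype.ext_iff, Submonoid.coe_mul]
    exact ⟨mul_right_congr h.ge, mul_right_congr h.le⟩
  exact le_sup_right (a := greenLStar (DDP n)) this

/-- The chain is a L* e R* g L* b, with e the partial identity on the domain of g. -/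
theorem greenDStar_of_link {a b g : DDP n} (h : (a : SymInv n).imZ = (g : SymInv n).domZ)
    (h' : (g : SymInv n).imZ = (b : SymInv n).imZ) : greenDStar (DDP n) a b := by
  obtain ⟨e, h1, h2, -, h3, -⟩ := exists_partial_id (domZ_subset (g : SymInv n))
  let e' : DDP n := ⟨e, h3⟩
  have k1 : greenDStar (DDP n) a e' := greenDStar_of_imZ_eq (h.trans h2.symm)
  have k2 : greenDStar (DDP n) e' g := greenDStar_of_domZ_eq h1
  exact Setoid.trans' _ k1 (Setoid.trans' _ k2 (greenDStar_of_imZ_eq h'))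

theorem greenDStar_of_translate {a b : DDP n}
    (h : Translate (a : SymInv n).imZ (b : SymInv n).imZ) : greenDStar (DDP n) a b := by
  have key : ∀ (a b : DDP n) (t : ℤ), t ≤ 0 →
      (∀ z, z ∈ (a : SymInv n).imZ ↔ z + t ∈ (b : SymInv n).imZ) → greenDStar (DDP n) a b := by
    intro a b t ht h
    obtain ⟨γ, h1, h2, h3⟩ := exists_translation (imZ_subset _) (imZ_subset _) h
    let g : DDP n := ⟨γ, mem_DDP_of_translation ht fun x y h => (h3 x y h).2⟩
    exact greenDStar_of_link (g := g) h1.symm h2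
  -- One of the two opposite translations is order-decreasing, and D* is symmetric.
  obtain ⟨t, ht⟩ := h
  rcases le_total t 0 with h0 | h0
  · exact key a b t h0 ht
  · refine Setoid.symm' _ (key b a (-t) (by omega) fun z => ?_)
    rw [ht, neg_add_cancel_right]

theorem greenDStar_of_reflection {a b : DDP n} (ha : Narrow n (a : SymInv n).imZ)
    (h : Reflection (a : SymInv n).imZ (b : SymInv n).imZ) : greenDStar (DDP n) a b := by
  by_cases hne : (a : SymInv n).imZ.Nonempty
  · have hfin : (a : SymInv n).imZ.Finite := (Set.finite_Ico _ _).subset (imZ_subset _)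
    obtain ⟨M, hM, hmax⟩ := hfin.exists_maximalFor id _ hne
    replace hmax : ∀ z ∈ (a : SymInv n).imZ, z ≤ M := fun z hz => by
      rcases le_total z M with h | h
      · exact h
      · exact hmax hz h
    -- This shift takes the maximum to n - 1. `A` is the shifted image and `A'` its reflection under
    -- z ↦ n - 1 - z; narrowness puts all of `A` in the right half of the chain, where that
    -- reflection is decreasing.
    set t : ℤ := n - 1 - M
    have hsub := imZ_subset (a : SymInv n)
    have hMn := (hsub hM).2
    let A : Set ℤ := {z | z - t ∈ (a : SymInv n).imZ}
    let A' : Set ℤ := {z | n - 1 - z - t ∈ (a : SymInv n).imZ}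
    have hA : A ⊆ Set.Ico 0 (n : ℤ) := fun z hz => by
      have h1 := hmax _ hz
      have h2 := (hsub hz).1
      constructor <;> omega
    have hA' : A' ⊆ Set.Ico 0 (n : ℤ) := fun z hz => by
      have h1 := hmax _ hz
      have h2 := (hsub hz).1
      constructor <;> omega
    obtain ⟨e, -, h2, -, h3, -⟩ := exists_partial_id hA
    obtain ⟨e', -, h2', -, h3', -⟩ := exists_partial_id hA'
    obtain ⟨γ, k1, k2, k3⟩ := exists_graph hA hA' (fun z => n - 1 - z)
      (fun x y h => by simp only at h; omega)
      (fun z hz => by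
        change (n : ℤ) - 1 - (n - 1 - z) - t ∈ (a : SymInv n).imZ
        rwa [sub_sub_cancel])
      (fun z hz => ⟨n - 1 - z, hz, by simp⟩)
    let g : DDP n := ⟨γ, mem_DDP_of_reflection fun x y h => ⟨(k3 x y h).2, by
      have := ha _ hM _ (k3 x y h).1
      omega⟩⟩
    have r1 : Translate (a : SymInv n).imZ A := ⟨t, fun z => by simp [A]⟩
    have r2 : Reflection A' A := ⟨n - 1, fun z => by simp [A, A']⟩
    have s1 : greenDStar (DDP n) a ⟨e, h3⟩ := greenDStar_of_translate (by simpa [h2] using r1)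
    have s2 : greenDStar (DDP n) ⟨e, h3⟩ ⟨e', h3'⟩ :=
      greenDStar_of_link (g := g) (h2.trans k1.symm) (k2.trans h2'.symm)
    have s3 : greenDStar (DDP n) ⟨e', h3'⟩ b := greenDStar_of_translate (by
      simpa [h2'] using r2.trans (r1.symm.trans_reflection h))
    exact Setoid.trans' _ s1 (Setoid.trans' _ s2 s3)
  · apply greenDStar_of_translate
    obtain ⟨c, hc⟩ := h
    rw [Set.not_nonempty_iff_eq_empty] at hne
    refine ⟨0, fun z => ?_⟩
    have := hc (c - z)
    rw [sub_sub_cancel] at this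
    rw [add_zero, ← this, hne]
    simp

theorem greenDStar_iff {a b : DDP n} :
    greenDStar (DDP n) a b ↔ Sim n (a : SymInv n).imZ (b : SymInv n).imZ := by
  constructor
  · have : greenDStar (DDP n) ≤ (simSetoid n).comap fun a : DDP n => (a : SymInv n).imZ := by
      refine sup_le ?_ ?_
      · intro a b h
        have key : ∀ a b : DDP n, greenLStar (DDP n) a b →
            (b : SymInv n).imZ ⊆ (a : SymInv n).imZ := by
          intro a b h
          obtain ⟨e, h1, -, -, h2, h3⟩ := exists_partial_id (imZ_subset (a : SymInv n))
          refine imZ_subset_of_mul_eq h3 ?_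
          -- The partial identity `e` on the image of `a` acts on `a` as 1; by L* it acts so on `b`,
          -- which confines the image of `b`.
          have : a * ⟨e, h2⟩ = a * 1 := Subtype.ext <| ext_maps fun x y => by
            rw [mul_one]
            change (_ * e).Maps _ _ ↔ _
            rw [maps_mul]
            constructor
            · rintro ⟨z, hz, h⟩
              rwa [← (h3 _ _ h).1]
            · intro hxy
              have : ((y : ℕ) : ℤ) ∈ e.domZ := h1 ▸ ⟨x, y, hxy, rfl⟩
              obtain ⟨y', hy'⟩ := (mem_domZ y).1 this
              obtain rfl := (h3 _ _ hy').1
              exact ⟨y, hxy, hy'⟩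
          have := congrArg Subtype.val ((h _ _).1 this)
          rwa [mul_one] at this
        have e := subset_antisymm (key a b h) (key b a (Setoid.symm' _ h))
        change Sim n (a : SymInv n).imZ (b : SymInv n).imZ
        rw [e]
        exact .inl (.refl _)
      · intro a b h
        have key : ∀ a b : DDP n, greenRStar (DDP n) a b →
            (b : SymInv n).domZ ⊆ (a : SymInv n).domZ := by
          intro a b h
          obtain ⟨e, h1, -, -, h2, h3⟩ := exists_partial_id (domZ_subset (a : SymInv n))
          refine domZ_subset_of_mul_eq h3 ?_
          have : ⟨e, h2⟩ * a = 1 * a := Subtype.ext <| ext_maps fun x y => by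
            rw [one_mul]
            change (e * _).Maps _ _ ↔ _
            rw [maps_mul]
            constructor
            · rintro ⟨z, h, hz⟩
              rwa [(h3 _ _ h).1]
            · intro hxy
              have : ((x : ℕ) : ℤ) ∈ e.domZ := h1 ▸ ⟨x, y, hxy, rfl⟩
              obtain ⟨y', hy'⟩ := (mem_domZ x).1 this
              obtain rfl := (h3 _ _ hy').1
              exact ⟨x, hy', hxy⟩
          have := congrArg Subtype.val ((h _ _).1 this)
          rwa [one_mul] at this
        have e := subset_antisymm (key a b h) (key b a (Setoid.symm' _ h))
        have h1 := sim_of_mem_DDP a.2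
        have h2 := sim_of_mem_DDP b.2
        rw [e] at h2
        exact h1.symm.trans h2
    exact fun h => this h
  · rintro (h | ⟨h, k⟩)
    · exact greenDStar_of_translate h
    · exact greenDStar_of_reflection h k

end Classes

/-! ### Shapes and their mirror images -/

/-- The largest element of a nonempty finite set of integers. -/
noncomputable def top (S : Finset ℤ) : ℤ := sSup (S : Set ℤ)

theorem top_mem {S : Finset ℤ} (h : S.Nonempty) : top S ∈ S :=
  Finset.Nonempty.csSup_mem h

theorem le_top_of_mem {S : Finset ℤ} {x : ℤ} (h : x ∈ S) : x ≤ top S :=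
  le_csSup S.finite_toSet.bddAbove h

theorem top_eq {S : Finset ℤ} {w : ℤ} (hw : w ∈ S) (h : ∀ x ∈ S, x ≤ w) : top S = w :=
  le_antisymm (h _ (top_mem ⟨w, hw⟩)) (le_top_of_mem hw)

/-- The mirror image of a finite set of integers with smallest element `0`. -/
noncomputable def mirror (S : Finset ℤ) : Finset ℤ := S.image fun x => top S - x

theorem mem_mirror {S : Finset ℤ} {x : ℤ} : x ∈ mirror S ↔ top S - x ∈ S := by
  simp only [mirror, Finset.mem_image]
  constructor
  · rintro ⟨y, hy, rfl⟩
    simpa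
  · exact fun h => ⟨_, h, by simp⟩

theorem card_mirror (S : Finset ℤ) : (mirror S).card = S.card :=
  Finset.card_image_of_injective _ fun x y h => by simpa using h

/-- The subsets of `{0, …, M}` of size `p` that contain `0`. -/
noncomputable def shapes (M : ℤ) (p : ℕ) : Finset (Finset ℤ) :=
  (Finset.Icc 0 M).powerset.filter fun S => 0 ∈ S ∧ S.card = p

theorem mem_shapes {M : ℤ} {p : ℕ} {S : Finset ℤ} :
    S ∈ shapes M p ↔ (∀ x ∈ S, 0 ≤ x ∧ x ≤ M) ∧ 0 ∈ S ∧ S.card = p := by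
  simp [shapes, Finset.subset_iff]

theorem top_mirror {M : ℤ} {p : ℕ} {S : Finset ℤ} (h : S ∈ shapes M p) :
    top (mirror S) = top S := by
  obtain ⟨h1, h2, -⟩ := mem_shapes.1 h
  refine top_eq (mem_mirror.2 (by simpa)) fun x hx => ?_
  have := (h1 _ (mem_mirror.1 hx)).1
  omega

theorem mirror_mirror {M : ℤ} {p : ℕ} {S : Finset ℤ} (h : S ∈ shapes M p) :
    mirror (mirror S) = S := by
  ext x
  rw [mem_mirror, top_mirror h, mem_mirror, sub_sub_cancel]

theorem mirror_mem_shapes {M : ℤ} {p : ℕ} {S : Finset ℤ} (h : S ∈ shapes M p) :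
    mirror S ∈ shapes M p := by
  obtain ⟨h1, h2, h3⟩ := mem_shapes.1 h
  refine mem_shapes.2 ⟨fun x hx => ?_, mem_mirror.2 ?_, by rw [card_mirror, h3]⟩
  · rw [mem_mirror] at hx
    have := le_top_of_mem hx
    have := h1 _ hx
    have := h1 _ (top_mem ⟨0, h2⟩)
    omega
  · rw [sub_zero]
    exact top_mem ⟨0, h2⟩

/-- Deleting 0 leaves an arbitrary `p`-subset of {1, …, M}. -/
theorem card_shapes (M p : ℕ) : (shapes M (p + 1)).card = M.choose p := by
  have h0 : ∀ T ∈ (Finset.Icc (1 : ℤ) M).powersetCard p, (0 : ℤ) ∉ T := by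
    intro T hT h
    have := (Finset.mem_powersetCard.1 hT).1 h
    simp at this
  have : shapes M (p + 1) = ((Finset.Icc (1 : ℤ) M).powersetCard p).image (insert 0) := by
    ext S
    simp only [mem_shapes, Finset.mem_image]
    constructor
    · rintro ⟨h1, h2, h3⟩
      refine ⟨S.erase 0, Finset.mem_powersetCard.2 ⟨fun x hx => ?_, ?_⟩, Finset.insert_erase h2⟩
      · obtain ⟨hx, hxS⟩ := Finset.mem_erase.1 hx
        have := h1 x hxS
        rw [Finset.mem_Icc]
        omega
      · rw [Finset.card_erase_of_mem h2, h3, Nat.add_sub_cancel]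
    · rintro ⟨T, hT, rfl⟩
      have h := h0 T hT
      rw [Finset.mem_powersetCard] at hT
      refine ⟨fun x hx => ?_, Finset.mem_insert_self _ _, ?_⟩
      · rcases Finset.mem_insert.1 hx with rfl | hx
        · omega
        · have := Finset.mem_Icc.1 (hT.1 hx)
          omega
      · rw [Finset.card_insert_of_notMem h, hT.2]
  rw [this, Finset.card_image_of_injOn, Finset.card_powersetCard]
  · simp
  · intro T hT U hU h
    change insert 0 T = insert 0 U at h
    rw [← Finset.erase_insert (h0 T hT), h, Finset.erase_insert (h0 U hU)]

/-! ### Folding symmetric shapes at their centre -/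

/-- The symmetric set with right half `U`, reflected at `top U - δ / 2`. -/
noncomputable def unfold (δ : ℤ) (U : Finset ℤ) : Finset ℤ :=
  U.image (fun u => top U - u) ∪ U.image (fun u => top U - δ + u)

/-- The right half of a set with largest element `2 * c - δ`, recentred at `c`. -/
noncomputable def fold (δ : ℤ) (S : Finset ℤ) : Finset ℤ :=
  (S.filter fun x => x ≤ (top S + δ) / 2 - δ).image fun x => (top S + δ) / 2 - x

theorem mem_unfold {δ : ℤ} {U : Finset ℤ} {x : ℤ} :
    x ∈ unfold δ U ↔ top U - x ∈ U ∨ x - top U + δ ∈ U := by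
  simp only [unfold, Finset.mem_union, Finset.mem_image]
  refine or_congr ⟨?_, fun h => ⟨_, h, by ring⟩⟩ ⟨?_, fun h => ⟨_, h, by ring⟩⟩
  · rintro ⟨u, hu, rfl⟩
    simpa
  · rintro ⟨u, hu, rfl⟩
    rwa [show top U - δ + u - top U + δ = u by ring]

theorem mem_fold {δ : ℤ} {S : Finset ℤ} {u : ℤ} :
    u ∈ fold δ S ↔ δ ≤ u ∧ (top S + δ) / 2 - u ∈ S := by
  simp only [fold, Finset.mem_image, Finset.mem_filter]
  constructor
  · rintro ⟨x, ⟨hx, h⟩, rfl⟩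
    exact ⟨by omega, by simpa⟩
  · rintro ⟨h, hu⟩
    exact ⟨_, ⟨hu, by omega⟩, by ring⟩

/-- The right halves of the symmetric shapes. -/
noncomputable def halves (M δ : ℤ) (p : ℕ) : Finset (Finset ℤ) :=
  (Finset.Icc δ ((M + δ) / 2)).powerset.filter fun U => U.Nonempty ∧ (unfold δ U).card = p

theorem mem_halves {M δ : ℤ} {p : ℕ} {U : Finset ℤ} : U ∈ halves M δ p ↔
    (∀ u ∈ U, δ ≤ u ∧ u ≤ (M + δ) / 2) ∧ U.Nonempty ∧ (unfold δ U).card = p := by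
  simp [halves, Finset.subset_iff]

/-- The symmetric shapes. -/
noncomputable def palindromes (M : ℤ) (p : ℕ) : Finset (Finset ℤ) :=
  (shapes M p).filter fun S => mirror S = S

section Fold

variable {M δ : ℤ} {p : ℕ}

theorem top_fold {S : Finset ℤ} (hδ : 0 ≤ δ ∧ δ ≤ 1) (hS : S ∈ shapes M p)
    (hpar : top S % 2 = δ) : (top S + δ) / 2 ∈ fold δ S ∧ top (fold δ S) = (top S + δ) / 2 := by
  obtain ⟨h1, h2, -⟩ := mem_shapes.1 hS
  have h0 := le_top_of_mem h2
  have : (top S + δ) / 2 ∈ fold δ S := mem_fold.2 ⟨by omega, by simpa⟩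
  refine ⟨this, top_eq this fun u hu => ?_⟩
  have := (h1 _ (mem_fold.1 hu).2).1
  omega

/-- With c = (top S + δ)/2, `fold` records the distances c - x of the points x ≤ c - δ; symmetry
recovers the rest. The parity δ of the top tells whether the centre c - δ/2 is an integer. -/
theorem unfold_fold {S : Finset ℤ} (hδ : 0 ≤ δ ∧ δ ≤ 1) (hS : S ∈ palindromes M p)
    (hpar : top S % 2 = δ) : unfold δ (fold δ S) = S := by
  obtain ⟨hS, hm⟩ := Finset.mem_filter.1 hS
  ext x
  have hx : x ∈ S ↔ top S - x ∈ S := by rw [← mem_mirror, hm]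
  rw [mem_unfold, mem_fold, mem_fold, (top_fold hδ hS hpar).2, sub_sub_cancel,
    show (top S + δ) / 2 - (x - (top S + δ) / 2 + δ) = top S - x by omega, ← hx]
  constructor
  · rintro (h | h) <;> exact h.2
  · intro h
    rcases le_total x ((top S + δ) / 2 - δ) with h' | h'
    · exact .inl ⟨by omega, h⟩
    -- The boundary point belongs to the left half; when δ = 1 it fails the condition x ≥ c of the
    -- right half.
    · by_cases h'' : x = (top S + δ) / 2 - δ
      · exact .inl ⟨by omega, h⟩
      · exact .inr ⟨by omega, h⟩

theorem top_unfold {U : Finset ℤ} (hU : U ∈ halves M δ p) (hδ : 0 ≤ δ) :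
    2 * top U - δ ∈ unfold δ U ∧ top (unfold δ U) = 2 * top U - δ := by
  obtain ⟨h1, h2, -⟩ := mem_halves.1 hU
  have h3 := top_mem h2
  have : 2 * top U - δ ∈ unfold δ U :=
    mem_unfold.2 (.inr (by rwa [show 2 * top U - δ - top U + δ = top U by ring]))
  refine ⟨this, top_eq this fun x hx => ?_⟩
  have h4 := h1 _ h3
  rcases mem_unfold.1 hx with hx | hx
  · have := h1 _ hx
    omega
  · have := le_top_of_mem hx
    omega

theorem unfold_mem_palindromes {U : Finset ℤ} (hU : U ∈ halves M δ p) (hδ : 0 ≤ δ) :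
    unfold δ U ∈ palindromes M p := by
  obtain ⟨h1, h2, h3⟩ := mem_halves.1 hU
  have h4 := h1 _ (top_mem h2)
  refine Finset.mem_filter.2 ⟨mem_shapes.2 ⟨fun x hx => ?_, ?_, h3⟩, ?_⟩
  · have := le_top_of_mem hx
    rw [(top_unfold hU hδ).2] at this
    rcases mem_unfold.1 hx with hx | hx
    · have := le_top_of_mem hx
      omega
    · have := h1 _ hx
      omega
  · exact mem_unfold.2 (.inl (by simpa using top_mem h2))
  · ext x
    rw [mem_mirror, (top_unfold hU hδ).2, mem_unfold, mem_unfold, or_comm,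
      show 2 * top U - δ - x - top U + δ = top U - x by ring,
      show top U - (2 * top U - δ - x) = x - top U + δ by ring]

theorem fold_unfold {U : Finset ℤ} (hU : U ∈ halves M δ p) (hδ : 0 ≤ δ) :
    fold δ (unfold δ U) = U := by
  obtain ⟨h1, h2, -⟩ := mem_halves.1 hU
  ext u
  rw [mem_fold, (top_unfold hU hδ).2, show (2 * top U - δ + δ) / 2 = top U by omega, mem_unfold,
    sub_sub_cancel, show top U - u - top U + δ = δ - u by ring]
  constructor
  · rintro ⟨h, h' | h'⟩
    · exact h'
    -- Both u and δ - u are at least δ ≥ 0, so this happens only at the central point u = δ = 0.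
    · have := h1 _ h'
      rwa [show u = δ - u by omega]
  · exact fun h => ⟨(h1 u h).1, .inl h⟩

theorem card_palindromes_filter (hδ : 0 ≤ δ ∧ δ ≤ 1) :
    ((palindromes M p).filter fun S => top S % 2 = δ).card = (halves M δ p).card := by
  refine Finset.card_nbij' (fold δ) (unfold δ) ?_ ?_ ?_ ?_
  · intro S hS
    obtain ⟨hS, hpar⟩ := Finset.mem_filter.1 hS
    have hS' := (Finset.mem_filter.1 hS).1
    obtain ⟨h1, h2, h3⟩ := mem_shapes.1 hS'
    obtain ⟨h4, h5⟩ := top_fold hδ hS' hpar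
    refine mem_halves.2 ⟨fun u hu => ⟨(mem_fold.1 hu).1, ?_⟩, ⟨_, h4⟩, ?_⟩
    · have := le_top_of_mem hu
      have := (h1 _ (top_mem ⟨0, h2⟩)).2
      omega
    · rw [unfold_fold hδ hS hpar, h3]
  · intro U hU
    refine Finset.mem_filter.2 ⟨unfold_mem_palindromes hU hδ.1, ?_⟩
    rw [(top_unfold hU hδ.1).2]
    omega
  · intro S hS
    obtain ⟨hS, hpar⟩ := Finset.mem_filter.1 hS
    exact unfold_fold hδ hS hpar
  · intro U hU
    exact fold_unfold hU hδ.1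

theorem card_palindromes : (palindromes M p).card = (halves M 0 p).card + (halves M 1 p).card := by
  rw [← card_palindromes_filter (by simp), ← card_palindromes_filter (by simp),
    ← Finset.card_filter_add_card_filter_not (s := palindromes M p) fun S => top S % 2 = 0]
  congr 3
  ext S
  omega

/-- The two halves meet only where u + v = δ with u, v ≥ δ ≥ 0, that is at u = v = 0. -/
theorem card_unfold_of_notMem {U : Finset ℤ} (h : ∀ u ∈ U, δ ≤ u) (hδ : 0 ≤ δ) (h0 : 0 ∉ U) :
    (unfold δ U).card = 2 * U.card := by
  rw [unfold, Finset.card_union_of_disjoint, Finset.card_image_of_injective,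
    Finset.card_image_of_injective, two_mul]
  · exact fun x y h => by simpa using h
  · exact fun x y h => by simpa using h
  · rw [Finset.disjoint_left]
    simp only [Finset.mem_image, not_exists, not_and]
    rintro _ ⟨u, hu, rfl⟩ v hv e
    have h1 := h u hu
    have h2 := h v hv
    obtain rfl : u = 0 := by omega
    exact h0 hu

theorem card_unfold_of_mem {U : Finset ℤ} (h : ∀ u ∈ U, 0 ≤ u) (h0 : 0 ∈ U) :
    (unfold 0 U).card + 1 = 2 * U.card := by
  have : U.image (fun u => top U - u) ∩ U.image (fun u => top U - 0 + u) = {top U} := by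
    ext x
    simp only [Finset.mem_inter, Finset.mem_image, Finset.mem_singleton]
    constructor
    · rintro ⟨⟨u, hu, rfl⟩, v, hv, e⟩
      have := h u hu
      have := h v hv
      omega
    · rintro rfl
      exact ⟨⟨0, h0, by simp⟩, 0, h0, by simp⟩
  rw [← Finset.card_singleton (top U), ← this, unfold, Finset.card_union_add_card_inter,
    Finset.card_image_of_injective, Finset.card_image_of_injective, two_mul]
  · exact fun x y h => by simpa using h
  · exact fun x y h => by simpa using h

end Fold

/-! ### Counting palindromes -/

theorem card_halves_odd (M k : ℕ) : (halves M 0 (2 * k + 1)).card = (M / 2).choose k := by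
  rw [← card_shapes]
  congr 1
  ext U
  rw [mem_halves, mem_shapes]
  push_cast
  simp only [add_zero]
  refine and_congr_right fun h => ⟨?_, ?_⟩
  -- Odd size forces a central point, so 0 ∈ U and |U| = k + 1: the halves are themselves shapes.
  · rintro ⟨h1, h2⟩
    by_cases h0 : 0 ∈ U
    · have := card_unfold_of_mem (fun u hu => (h u hu).1) h0
      exact ⟨h0, by omega⟩
    · have := card_unfold_of_notMem (fun u hu => (h u hu).1) le_rfl h0
      omega
  · rintro ⟨h0, h2⟩
    have := card_unfold_of_mem (fun u hu => (h u hu).1) h0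
    exact ⟨⟨0, h0⟩, by omega⟩

theorem halves_one_odd (M k : ℕ) : halves M 1 (2 * k + 1) = ∅ := by
  refine Finset.eq_empty_of_forall_notMem fun U hU => ?_
  obtain ⟨h1, -, h3⟩ := mem_halves.1 hU
  have := card_unfold_of_notMem (fun u hu => (h1 u hu).1) zero_le_one
    (fun h => by have := h1 0 h; omega)
  omega

/-- Even size excludes a central point, leaving arbitrary `k`-subsets of {1, …, (M + δ)/2}. For k =
0 the formula would fail, since halves are nonempty. -/
theorem card_halves_even (M δ k : ℕ) (hδ : δ ≤ 1) (hk : 0 < k) :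
    (halves M δ (2 * k)).card = ((M + δ) / 2).choose k := by
  have : halves M δ (2 * k) = (Finset.Icc (1 : ℤ) ((M + δ) / 2)).powersetCard k := by
    ext U
    rw [mem_halves, Finset.mem_powersetCard, Finset.subset_iff]
    constructor
    · rintro ⟨h, h1, h2⟩
      have h0 : 0 ∉ U := by
        intro h0
        obtain rfl : δ = 0 := by
          have := h 0 h0
          omega
        have := card_unfold_of_mem (fun u hu => (h u hu).1) h0
        simp only [Nat.cast_zero] at h2
        omega
      have := card_unfold_of_notMem (fun u hu => (h u hu).1) (by omega) h0
      refine ⟨fun x hx => ?_, by omega⟩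
      have := h x hx
      have : x ≠ 0 := fun e => h0 (e ▸ hx)
      rw [Finset.mem_Icc]
      omega
    · rintro ⟨h, h2⟩
      have h' : ∀ u ∈ U, (δ : ℤ) ≤ u ∧ u ≤ (M + δ) / 2 := fun u hu => by
        have := Finset.mem_Icc.1 (h hu)
        omega
      refine ⟨h', Finset.card_pos.1 (by omega), ?_⟩
      rw [card_unfold_of_notMem (fun u hu => (h' u hu).1) (by omega), h2]
      intro h0
      have := Finset.mem_Icc.1 (h h0)
      omega
  rw [this, Finset.card_powersetCard, Int.card_Icc]
  congr 1
  omega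

theorem card_palindromes_odd (M k : ℕ) :
    (palindromes M (2 * k + 1)).card = (M / 2).choose k := by
  rw [card_palindromes, card_halves_odd, halves_one_odd, Finset.card_empty, add_zero]

theorem card_palindromes_even (M k : ℕ) (hk : 0 < k) :
    (palindromes M (2 * k)).card = (M / 2).choose k + ((M + 1) / 2).choose k := by
  have h0 := card_halves_even M 0 k zero_le_one hk
  have h1 := card_halves_even M 1 k le_rfl hk
  rw [card_palindromes]
  simpa using congrArg₂ (· + ·) h0 h1

/-- An involution without fixed points pairs off the elements of a finite set. -/
theorem two_mul_card_image_pairs {α β : Type*} [DecidableEq α] [DecidableEq (Sym2 β)]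
    (N : Finset α) (r : α → α) (f : α → β) (hr : ∀ a ∈ N, r a ∈ N) (hrr : ∀ a ∈ N, r (r a) = a)
    (hne : ∀ a ∈ N, r a ≠ a) (hf : Set.InjOn f N) :
    N.card = 2 * (N.image fun a => s(f a, f (r a))).card := by
  rw [Finset.card_eq_sum_card_image (fun a => s(f a, f (r a))) N, mul_comm, ← smul_eq_mul,
    ← Finset.sum_const]
  refine Finset.sum_congr rfl fun P hP => ?_
  obtain ⟨a, ha, rfl⟩ := Finset.mem_image.1 hP
  -- The fibre over the pair of `a` is exactly {a, r a}.
  rw [← Finset.card_pair (hne a ha).symm]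
  congr 1
  ext b
  simp only [Finset.mem_filter, Finset.mem_insert, Finset.mem_singleton, Sym2.eq_iff]
  constructor
  · rintro ⟨hb, ⟨h, -⟩ | ⟨h, -⟩⟩
    · exact .inl (hf hb ha h)
    · exact .inr (hf hb (hr a ha) h)
  · rintro (rfl | rfl)
    · exact ⟨ha, .inl ⟨rfl, rfl⟩⟩
    · exact ⟨hr a ha, .inr ⟨rfl, by rw [hrr a ha]⟩⟩

/-! ### From classes to shapes, and the count of merged pairs -/

section Counting

open SymInv

/-- The maps in `ODP n` whose image is a translate of `S`. -/
def translateClass (n : ℕ) (S : Finset ℤ) : Set (ODP n) :=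
  {a | Translate (a : SymInv n).imZ S}

theorem Translate.ncard_eq {A B : Set ℤ} : Translate A B → A.ncard = B.ncard := by
  rintro ⟨t, h⟩
  have : B = (· + t) '' A := by
    ext z
    constructor
    · exact fun hz => ⟨z - t, (h _).2 (by simpa), by simp⟩
    · rintro ⟨y, hy, rfl⟩
      exact (h y).1 hy
  rw [this, Set.ncard_image_of_injective _ (add_left_injective t)]

variable {n p : ℕ} {S T : Finset ℤ}

theorem exists_partial_id_of_shape (hS : S ∈ shapes ((n : ℤ) - 1) p) :
    ∃ γ : SymInv n, γ.imZ = S ∧ γ ∈ ODP n ∧ γ ∈ DDP n := by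
  obtain ⟨γ, -, h, h1, h2, -⟩ := exists_partial_id (n := n) (A := (S : Set ℤ)) fun x hx => by
    have := (mem_shapes.1 hS).1 x hx
    constructor <;> omega
  exact ⟨γ, h, h1, h2⟩

theorem translateClass_eq (a : ODP n) (h : (a : SymInv n).imZ = S) :
    translateClass n S = {b | greenD (ODP n) b a} := by
  ext b
  rw [Set.mem_ofPred_eq, greenD_iff, h]
  rfl

theorem translateClass_mem_heightClasses (hS : S ∈ shapes ((n : ℤ) - 1) p) :
    translateClass n S ∈ heightClasses n p := by
  obtain ⟨γ, h, h1, -⟩ := exists_partial_id_of_shape hS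
  refine ⟨?_, fun a ha => ?_⟩
  · rw [translateClass_eq ⟨γ, h1⟩ h]
    exact Setoid.mem_classes _ _
  · rw [height_eq_ncard_imZ, Translate.ncard_eq ha, Set.ncard_coe_finset]
    exact (mem_shapes.1 hS).2.2

theorem exists_shape_translate {A : Set ℤ} (hA : A ⊆ Set.Ico 0 (n : ℤ)) (hne : A.Nonempty) :
    ∃ S ∈ shapes ((n : ℤ) - 1) A.ncard, Translate A S := by
  have hfin : A.Finite := (Set.finite_Ico _ _).subset hA
  obtain ⟨m, hm, hmin⟩ := hfin.exists_minimalFor id _ hne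
  replace hmin : ∀ z ∈ A, m ≤ z := fun z hz => (le_total m z).elim id fun h => hmin hz h
  have ht : Translate A (hfin.toFinset.image (· - m) : Finset ℤ) := ⟨-m, fun z => by
    simp [← sub_eq_add_neg]⟩
  refine ⟨_, mem_shapes.2 ⟨fun x hx => ?_, ?_, ?_⟩, ht⟩
  · obtain ⟨z, hz, rfl⟩ := Finset.mem_image.1 hx
    rw [Set.Finite.mem_toFinset] at hz
    have := hmin z hz
    have := (hA hz).2
    have := (hA hm).1
    omega
  · exact Finset.mem_image.2 ⟨m, by simpa, by simp⟩
  · rw [ht.ncard_eq, Set.ncard_coe_finset]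

theorem exists_eq_translateClass (hp : 1 ≤ p) {C : Set (ODP n)} (hC : C ∈ heightClasses n p) :
    ∃ S ∈ shapes ((n : ℤ) - 1) p, C = translateClass n S := by
  obtain ⟨⟨a, rfl⟩, h⟩ := hC
  have ha : (a : SymInv n).imZ.ncard = p := by
    rw [← height_eq_ncard_imZ]
    exact h a (show greenD (ODP n) a a from Setoid.refl' _ a)
  obtain ⟨S, hS, hT⟩ := exists_shape_translate (imZ_subset (a : SymInv n))
    (Set.nonempty_of_ncard_ne_zero (by omega))
  rw [ha] at hS
  refine ⟨S, hS, ?_⟩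
  ext b
  rw [Set.mem_ofPred_eq, greenD_iff]
  exact ⟨fun h => h.trans hT, fun h => Translate.trans h hT.symm⟩

/-- Both sets have minimum 0, so the shift and its negative are both nonnegative. -/
theorem eq_of_translate {M M' : ℤ} {p' : ℕ} (hS : S ∈ shapes M p) (hT : T ∈ shapes M' p')
    (h : Translate (S : Set ℤ) T) : S = T := by
  obtain ⟨t, ht⟩ := h
  obtain ⟨h1, h2, -⟩ := mem_shapes.1 hS
  obtain ⟨h1', h2', -⟩ := mem_shapes.1 hT
  have k1 := (h1' _ ((ht 0).1 h2)).1
  have k2 := (h1 (-t) ((ht _).2 (by simpa))).1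
  obtain rfl : t = 0 := by omega
  ext z
  simpa using ht z

theorem translateClass_injOn : Set.InjOn (translateClass n) (shapes ((n : ℤ) - 1) p) := by
  intro S hS T hT h
  obtain ⟨γ, h0, h1, -⟩ := exists_partial_id_of_shape hS
  have : (⟨γ, h1⟩ : ODP n) ∈ translateClass n T := by
    rw [← h]
    change Translate γ.imZ S
    rw [h0]
    exact .refl _
  change Translate γ.imZ T at this
  rw [h0] at this
  exact eq_of_translate hS hT this

theorem reflection_mirror (S : Finset ℤ) : Reflection (S : Set ℤ) (mirror S) :=
  ⟨top S, fun z => by simp [mem_mirror]⟩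

theorem narrow_iff (hn : 1 ≤ n) (hS : S ∈ shapes ((n : ℤ) - 1) p) :
    Narrow n S ↔ S ∈ shapes ((n - 1) / 2 : ℕ) p := by
  obtain ⟨h1, h2, h3⟩ := mem_shapes.1 hS
  constructor
  · intro h
    refine mem_shapes.2 ⟨fun x hx => ⟨(h1 x hx).1, ?_⟩, h2, h3⟩
    have := h x hx 0 h2
    omega
  · intro h x hx y hy
    have := (mem_shapes.1 h).1 x hx
    have := (mem_shapes.1 h).1 y hy
    omega

theorem merged_iff (hn : 1 ≤ n) (hS : S ∈ shapes ((n : ℤ) - 1) p)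
    (hT : T ∈ shapes ((n : ℤ) - 1) p) : Merged (translateClass n S) (translateClass n T) ↔
      S ≠ T ∧ S ∈ shapes ((n - 1) / 2 : ℕ) p ∧ T = mirror S := by
  obtain ⟨γ, a0, a1, a2⟩ := exists_partial_id_of_shape hS
  obtain ⟨γ', b0, b1, b2⟩ := exists_partial_id_of_shape hT
  rw [Merged, translateClass_injOn.ne_iff hS hT]
  refine and_congr_right fun hne => ⟨?_, ?_⟩
  · rintro ⟨K, ⟨c, rfl⟩, h, h'⟩
    -- The partial identities on S and T lie in both monoids, so neither decreasing part is empty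
    -- and the common class `K` really compares S with T.
    have ha : (⟨γ, a2⟩ : DDP n) ∈ decreasingPart (translateClass n S) :=
      ⟨⟨γ, a1⟩, show Translate γ.imZ S from a0 ▸ .refl _, rfl⟩
    have hb : (⟨γ', b2⟩ : DDP n) ∈ decreasingPart (translateClass n T) :=
      ⟨⟨γ', b1⟩, show Translate γ'.imZ T from b0 ▸ .refl _, rfl⟩
    have := greenDStar_iff.1 (Setoid.trans' _ (h ha) (Setoid.symm' _ (h' hb)))
    change Sim n γ.imZ γ'.imZ at this
    rw [a0, b0] at this
    rcases this with h | ⟨h, k⟩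
    · exact absurd (eq_of_translate hS hT h) hne
    · exact ⟨(narrow_iff hn hS).1 h,
        eq_of_translate hT (mirror_mem_shapes hS) (k.symm.trans (reflection_mirror S))⟩
  · rintro ⟨h, rfl⟩
    refine ⟨_, Setoid.mem_classes _ ⟨γ, a2⟩, ?_, ?_⟩
    · rintro b ⟨a, ha, e⟩
      refine greenDStar_iff.2 (.inl ?_)
      change Translate (b : SymInv n).imZ γ.imZ
      rw [← e, a0]
      exact ha
    · rintro b ⟨a, ha, e⟩
      refine greenDStar_iff.2 (Sim.symm (.inr ?_))
      change Narrow n γ.imZ ∧ Reflection γ.imZ (b : SymInv n).imZ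
      rw [← e, a0]
      exact ⟨(narrow_iff hn hS).2 h, (reflection_mirror S).trans_translate (Translate.symm ha)⟩

theorem shapes_mono {M M' : ℤ} (h : M ≤ M') : shapes M p ⊆ shapes M' p := by
  intro S hS
  obtain ⟨h1, h2⟩ := mem_shapes.1 hS
  exact mem_shapes.2 ⟨fun x hx => ⟨(h1 x hx).1, (h1 x hx).2.trans h⟩, h2⟩

/-- `mirror` is a fixed-point-free involution on the non-palindromic narrow shapes, and its orbits
are the merged pairs. -/
theorem two_mul_B (hp : 1 ≤ p) (hn : 1 ≤ n) :
    2 * B n p + (palindromes ((n - 1) / 2 : ℕ) p).card = ((n - 1) / 2).choose (p - 1) := by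
  classical
  set m : ℕ := (n - 1) / 2
  let N := (shapes m p).filter fun S => ¬ mirror S = S
  have hsub : shapes m p ⊆ shapes ((n : ℤ) - 1) p := shapes_mono (by omega)
  have hN : ∀ S, S ∈ N ↔ S ∈ shapes m p ∧ mirror S ≠ S := fun S => Finset.mem_filter
  have hB : B n p = (N.image fun S => s(translateClass n S, translateClass n (mirror S))).card := by
    rw [← Set.ncard_coe_finset]
    unfold B
    congr 1
    ext P
    simp only [Set.mem_ofPred_eq, Finset.coe_image, Set.mem_image, Finset.mem_coe, hN]
    constructor
    · rintro ⟨C, hC, C', hC', hM, rfl⟩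
      obtain ⟨S, hS, rfl⟩ := exists_eq_translateClass hp hC
      obtain ⟨T, hT, rfl⟩ := exists_eq_translateClass hp hC'
      obtain ⟨h1, h2, rfl⟩ := (merged_iff hn hS hT).1 hM
      exact ⟨S, ⟨h2, h1.symm⟩, rfl⟩
    · rintro ⟨S, ⟨hS, hne⟩, rfl⟩
      have hS' := mirror_mem_shapes (hsub hS)
      exact ⟨_, translateClass_mem_heightClasses (hsub hS), _,
        translateClass_mem_heightClasses hS',
        (merged_iff hn (hsub hS) hS').2 ⟨hne.symm, hS, rfl⟩, rfl⟩
  rw [hB, ← two_mul_card_image_pairs N mirror (translateClass n)]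
  · obtain ⟨q, rfl⟩ : ∃ q, p = q + 1 := ⟨p - 1, by omega⟩
    rw [Nat.add_sub_cancel, ← card_shapes, add_comm]
    exact Finset.card_filter_add_card_filter_not _
  · intro S hS
    rw [hN] at hS ⊢
    exact ⟨mirror_mem_shapes hS.1, by rw [mirror_mirror hS.1]; exact hS.2.symm⟩
  · exact fun S hS => mirror_mirror ((hN S).1 hS).1
  · exact fun S hS => ((hN S).1 hS).2
  · exact translateClass_injOn.mono fun S hS => hsub ((hN S).1 hS).1

end Counting

theorem theorem3p7 (n p : ℕ) (hp : 1 ≤ p) (hpn : p ≤ n) :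
    (Odd p →
      (B n p : ℚ) = 1 / 2 * ((Nat.choose ((n - 1) / 2) (p - 1) : ℚ)
        - (Nat.choose ((n - 1) / 4) ((p - 1) / 2) : ℚ))) ∧
    ((n ≡ 1 [MOD 4] ∨ n ≡ 2 [MOD 4]) → Even p →
      (B n p : ℚ) = 1 / 2 * ((Nat.choose ((n - 1) / 2) (p - 1) : ℚ)
        - 2 * (Nat.choose ((n - 1) / 4) (p / 2) : ℚ))) ∧
    ((n ≡ 3 [MOD 4] ∨ n ≡ 0 [MOD 4]) → Even p →
      (B n p : ℚ) = 1 / 2 * ((Nat.choose ((n - 1) / 2) (p - 1) : ℚ)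
        - 2 * (Nat.choose ((n - 3) / 4) (p / 2) : ℚ)
        - (Nat.choose ((n - 3) / 4) ((p - 2) / 2) : ℚ))) := by
  have key := two_mul_B hp (hp.trans hpn)
  refine ⟨?_, ?_, ?_⟩
  · rintro ⟨k, rfl⟩
    rw [card_palindromes_odd, Nat.div_div_eq_div_mul] at key
    rw [← key, show (2 * k + 1 - 1) / 2 = k by omega]
    push_cast
    ring
  · rintro hn ⟨k, rfl⟩
    rw [← two_mul] at key ⊢
    rw [card_palindromes_even _ _ (by omega)] at key
    simp only [Nat.ModEq] at hn
    -- Here m = ⌊(n-1)/2⌋ is even, so the integer and half-integer centres contribute equally.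
    rw [← key, show (n - 1) / 2 / 2 = (n - 1) / 4 by omega,
      show ((n - 1) / 2 + 1) / 2 = (n - 1) / 4 by omega, show 2 * k / 2 = k by omega]
    push_cast
    ring
  · rintro hn ⟨k, rfl⟩
    rw [← two_mul] at key ⊢
    rw [card_palindromes_even _ _ (by omega)] at key
    simp only [Nat.ModEq] at hn
    -- Here m is odd, so ⌊(m+1)/2⌋ = ⌊m/2⌋ + 1, and Pascal's rule splits the second binomial
    -- coefficient.
    obtain ⟨j, rfl⟩ : ∃ j, k = j + 1 := ⟨k - 1, by omega⟩
    rw [← key, show (n - 1) / 2 / 2 = (n - 3) / 4 by omega,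
      show ((n - 1) / 2 + 1) / 2 = (n - 3) / 4 + 1 by omega,
      show 2 * (j + 1) / 2 = j + 1 by omega, show (2 * (j + 1) - 2) / 2 = j by omega,
      Nat.choose_succ_succ]
    push_cast
    ring
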